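/- Let $n\ge 1$, let $M_n$ be the space of complex $n\times n$ matrices with its usual matrix ordering (an element of $M_p(M_n)=M_{pn}$ is positive iff it is positive semidefinite), and let the dual space $M_n^d$ carry the dual matrix ordering: $(f_{kl})\in M_p(M_n^d)$ is positive iff $X\mapsto (f_{kl}(X))$, $M_n\to M_p$, is completely positive. For a basis $\mathcal B$ of $M_n$ let $\mathcal D_{\mathcal B}:M_n\to M_n^d$ be the linear isomorphism taking each element of $\mathcal B$ to the corresponding element of the dual basis, and let $\widetilde{\mathcal D}_{\mathcal B}=\mathcal D_{\mathcal E}^{-1}\circ\mathcal D_{\mathcal B}:M_n\to M_n$, where $\mathcal E=\{E_{ij}\}$ is the standard basis of matrix units. An invertible linear map is an order isomorphism (complete order isomorphism) if it and its inverse are positive (completely positive). For $C\in M_n$ put $\Phi_C(X)=CXC^*$. (a) Let $(\lambda_{ij})\in M_n$ with all $\lambda_{ij}\neq 0$, and let $\mathcal B$ be the basis $\{\lambda_{ij}E_{ij}\}$. Then $\mathcal D_{\mathcal B}$ is an order isomorphism if and only if the matrix $(\lambda_{ij}^2)$ is positive semidefinite of rank one. In that case there are scalars $\alpha_1,\dots,\alpha_n\in\mathbb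 C$ such that $\lambda_{ij}^2=\alpha_i\overline{\alpha_j}$ for all $i,j$; for any such scalars, $C=\operatorname{diag}(\alpha_1,\dots,\alpha_n)$ is invertible and $\widetilde{\mathcal D}_{\mathcal B}^{-1}=\Phi_C$, i.e. $\widetilde{\mathcal D}_{\mathcal B}=\Phi_{C^{-1}}$; and $\mathcal D_{\mathcal B}$ is a complete order isomorphism. (b) Not every basis $\mathcal B$ of $M_n$ that is orthonormal for the Hilbert–Schmidt inner product $\langle A,B\rangle=\operatorname{tr}(AB^*)$ has the property that $\mathcal D_{\mathcal B}$ is an order isomorphism: if $\lambda_{11}=i$ (the imaginary unit) and $\lambda_{kl}=1$ for $(k,l)\neq(1,1)$, then $\{\lambda_{kl}E_{kl}\}$ is an orthonormal basis and its duality map is not an order isomorphism. -/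

import Mathlib

open scoped ComplexOrder

/-- `Mn n` is the space of `n × n` complex matrices. -/
abbrev Mn (n : ℕ) : Type := Matrix (Fin n) (Fin n) ℂ

/-- The compression `X* A X` of a `p × p` matrix `A` over a complex vector space `V`
by a scalar `p × q` matrix `X`. -/
def compression {V : Type*} [AddCommGroup V] [Module ℂ V] {p q : ℕ}
    (X : Matrix (Fin p) (Fin q) ℂ) (A : Matrix (Fin p) (Fin p) V) :
    Matrix (Fin q) (Fin q) V :=
  Matrix.of fun i j => ∑ k, ∑ l, (star (X k i) * X l j) • A k l

/-- A matrix ordering on a complex vector space `V`: a cone of positive elements in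
`M_p(V)` for every `p`, compatible with compressions by scalar matrices.
(Closure under direct sums follows, since `A ⊕ B` is a sum of two compressions.) -/
class MatrixOrdered (V : Type*) [AddCommGroup V] [Module ℂ V] where
  IsPos : ∀ {p : ℕ}, Matrix (Fin p) (Fin p) V → Prop
  isPos_zero : ∀ {p : ℕ}, IsPos (0 : Matrix (Fin p) (Fin p) V)
  isPos_add : ∀ {p : ℕ} {A B : Matrix (Fin p) (Fin p) V}, IsPos A → IsPos B → IsPos (A + B)
  isPos_smul : ∀ {p : ℕ} {c : ℂ} {A : Matrix (Fin p) (Fin p) V},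
    0 ≤ c → IsPos A → IsPos (c • A)
  isPos_compression : ∀ {p q : ℕ} (X : Matrix (Fin p) (Fin q) ℂ)
    {A : Matrix (Fin p) (Fin p) V}, IsPos A → IsPos (compression X A)

section Maps

variable {V W : Type*} [AddCommGroup V] [Module ℂ V] [MatrixOrdered V]
  [AddCommGroup W] [Module ℂ W] [MatrixOrdered W]

/-- The amplification `Φ^(p) : M_p(V) → M_p(W)`, which applies `Φ` to every entry,
maps positive elements to positive elements. -/
def IsPositiveAtLevel (p : ℕ) (Φ : V →ₗ[ℂ] W) : Prop :=
  ∀ A : Matrix (Fin p) (Fin p) V, MatrixOrdered.IsPos A → MatrixOrdered.IsPos (A.map Φ)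

/-- `Φ` is positive: it maps the cone of `V = M_1(V)` into the cone of `W = M_1(W)`. -/
def IsPositiveMap (Φ : V →ₗ[ℂ] W) : Prop := IsPositiveAtLevel 1 Φ

/-- `Φ` is completely positive. -/
def IsCompletelyPositive (Φ : V →ₗ[ℂ] W) : Prop := ∀ p : ℕ, IsPositiveAtLevel p Φ

/-- An invertible linear map is an order isomorphism if it and its inverse are positive. -/
def IsOrderIsomorphism (Φ : V ≃ₗ[ℂ] W) : Prop :=
  IsPositiveMap Φ.toLinearMap ∧ IsPositiveMap Φ.symm.toLinearMap

/-- An invertible linear map is a complete order isomorphism if it and its inverse are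
completely positive. -/
def IsCompleteOrderIsomorphism (Φ : V ≃ₗ[ℂ] W) : Prop :=
  IsCompletelyPositive Φ.toLinearMap ∧ IsCompletelyPositive Φ.symm.toLinearMap

end Maps

/-- The matrix ordering on `Mn n`: a `p × p` block matrix with entries in `Mn n` is positive
when, viewed as a `pn × pn` scalar matrix, it is positive semidefinite. -/
instance instMatrixOrderedMn (n : ℕ) : MatrixOrdered (Mn n) where
  IsPos {p} A := (Matrix.comp (Fin p) (Fin p) (Fin n) (Fin n) ℂ A).PosSemidef
  isPos_zero := by
    intro p
    exact Matrix.PosSemidef.zero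
  isPos_add := by
    intro p A B hA hB
    exact hA.add hB
  isPos_smul := by
    intro p c A hc hA
    exact hA.smul hc
  isPos_compression := by
    intro p q X A hA
    have h := hA.conjTranspose_mul_mul_same (Matrix.kroneckerMap (· * ·) X (1 : Mn n))
    convert h using 1
    ext ⟨i, a⟩ ⟨j, b⟩
    simp [compression, Matrix.mul_apply, Matrix.sum_apply, Fintype.sum_prod_type,
      Matrix.one_apply, Finset.sum_mul, apply_ite]
    rw [Finset.sum_comm]
    exact Finset.sum_congr rfl fun _ _ => Finset.sum_congr rfl fun _ _ => by ring

section Dual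

variable {V : Type*} [AddCommGroup V] [Module ℂ V]

/-- The linear map `V → M_p`, `v ↦ (f_{ij}(v))`, given by a matrix `(f_{ij})` of functionals. -/
def functionalMatrixMap {p : ℕ} (F : Matrix (Fin p) (Fin p) (Module.Dual ℂ V)) :
    V →ₗ[ℂ] Mn p where
  toFun v := Matrix.of fun i j => F i j v
  map_add' u v := by ext i j; simp
  map_smul' c v := by ext i j; simp

/-- The dual matrix ordering: a matrix of functionals `(f_{ij})` is positive when the map
`v ↦ (f_{ij}(v))` is completely positive. -/
instance instMatrixOrderedDual [MatrixOrdered V] : MatrixOrdered (Module.Dual ℂ V) where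
  IsPos {_} F := IsCompletelyPositive (functionalMatrixMap F)
  isPos_zero := by
    intro p r A _
    exact MatrixOrdered.isPos_zero (V := Mn p)
  isPos_add := by
    intro p F G hF hG r A hA
    exact MatrixOrdered.isPos_add (hF r A hA) (hG r A hA)
  isPos_smul := by
    intro p c F hc hF r A hA
    exact MatrixOrdered.isPos_smul hc (hF r A hA)
  isPos_compression := by
    intro p q X F hF r A hA
    have h := Matrix.PosSemidef.conjTranspose_mul_mul_same (hF r A hA)
      (Matrix.kroneckerMap (· * ·) (1 : Mn r) X)
    change Matrix.PosSemidef _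
    convert h using 1
    ext ⟨a, i⟩ ⟨b, j⟩
    simp [functionalMatrixMap, compression, Matrix.mul_apply, Fintype.sum_prod_type,
      Matrix.one_apply, Finset.sum_mul, apply_ite]
    rw [Finset.sum_comm]
    exact Finset.sum_congr rfl fun _ _ => Finset.sum_congr rfl fun _ _ => by ring

/-- The duality map of a basis: the linear isomorphism from `V` onto its dual that takes each
basis element to the corresponding element of the dual basis. -/
noncomputable def dualityMap {ι : Type*} [Finite ι] [DecidableEq ι] (b : Module.Basis ι ℂ V) :
    V ≃ₗ[ℂ] Module.Dual ℂ V :=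
  b.equiv b.dualBasis (Equiv.refl ι)

end Dual

/-- `Γ_E ∘ D_B : M_n → M_n`, where `D_B` is the duality map of the basis `b` and `Γ_E` is the
inverse of the duality map of the standard basis of matrix units. -/
noncomputable def dualityMapTilde {n : ℕ} {ι : Type*} [Finite ι] [DecidableEq ι]
    (b : Module.Basis ι ℂ (Mn n)) : Mn n ≃ₗ[ℂ] Mn n :=
  (dualityMap b).trans (dualityMap (Matrix.stdBasis ℂ (Fin n) (Fin n))).symm

/-- The map `Φ_C(X) = C X C*`. -/
def conjMap {n : ℕ} (C : Mn n) : Mn n →ₗ[ℂ] Mn n where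
  toFun X := C * X * C.conjTranspose
  map_add' X Y := by rw [Matrix.mul_add, Matrix.add_mul]
  map_smul' c X := by simp

/-- The basis `{λ_{ij} E_{ij}}` of `M_n`, for nonzero scalars `λ_{ij}`. -/
noncomputable def scaledBasis {n : ℕ} (lam : Mn n) (hlam : ∀ i j, lam i j ≠ 0) :
    Module.Basis (Fin n × Fin n) ℂ (Mn n) :=
  (Matrix.stdBasis ℂ (Fin n) (Fin n)).isUnitSMul (w := fun ij => lam ij.1 ij.2)
    fun ij => (hlam ij.1 ij.2).isUnit

/-- The basis is orthonormal for the Hilbert-Schmidt inner product `⟨A, B⟩ = tr(A B*)`. -/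
def IsHSOrthonormal {n : ℕ} {ι : Type*} [DecidableEq ι] (b : Module.Basis ι ℂ (Mn n)) : Prop :=
  ∀ i j, (b i * (b j).conjTranspose).trace = if i = j then 1 else 0

open Matrix

/-! The duality map of `{λ_{ij} E_{ij}}` is, up to the standard duality, entrywise multiplication by
`λ_{ij}⁻²`. If `λ_{ij}² = α_i conj(α_j)`, this is conjugation by an invertible diagonal matrix,
hence completely positive in both directions. Conversely, testing the map and its inverse on the
all-ones matrix and its functional shows that both `(λ_{ij}⁻²)` and `(λ_{ij}²)` are positive
semidefinite. Their `2 × 2` principal minors give opposite inequalities, so those of `(λ_{ij}²)`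
through the pivot `(0, 0)` vanish. By `Matrix.PosSemidef.minor_eq_zero` every column is then a
multiple of column `0`, and `Matrix.PosSemidef.exists_factor` yields `α`. In (b) positivity fails
because `i² = -1` lands on the diagonal. -/

theorem dualityMap_apply_apply {V ι : Type*} [AddCommGroup V] [Module ℂ V] [Fintype ι]
    [DecidableEq ι] (b : Module.Basis ι ℂ V) (X Y : V) :
    dualityMap b X Y = ∑ i, b.repr X i * b.repr Y i := by
  have h : dualityMap b X = ∑ i, b.repr X i • b.dualBasis i := by
    conv_lhs => rw [← b.sum_repr X, map_sum]
    simp [dualityMap]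
  simp [h]

theorem Matrix.stdBasis_repr_apply {n : ℕ} (X : Mn n) (ij : Fin n × Fin n) :
    (Matrix.stdBasis ℂ (Fin n) (Fin n)).repr X ij = X ij.1 ij.2 := by
  simp [Matrix.stdBasis]

theorem scaledBasis_apply {n : ℕ} (lam : Mn n) (hlam : ∀ i j, lam i j ≠ 0)
    (ij : Fin n × Fin n) :
    scaledBasis lam hlam ij = Matrix.single ij.1 ij.2 (lam ij.1 ij.2) := by
  obtain ⟨i, j⟩ := ij
  simp [scaledBasis, Module.Basis.isUnitSMul_apply, Matrix.stdBasis_eq_single]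

theorem scaledBasis_repr_apply {n : ℕ} (lam : Mn n) (hlam : ∀ i j, lam i j ≠ 0) (X : Mn n)
    (ij : Fin n × Fin n) :
    (scaledBasis lam hlam).repr X ij = X ij.1 ij.2 / lam ij.1 ij.2 := by
  rw [scaledBasis, Module.Basis.repr_isUnitSMul, Matrix.stdBasis_repr_apply, Units.smul_def,
    Units.val_inv_eq_inv_val, smul_eq_mul, IsUnit.unit_spec, div_eq_inv_mul]

/-- The duality map of `{λ_{ij} E_{ij}}` pairs `X` and `Y` to `∑ x_{ij} y_{ij} / λ_{ij}²`. -/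
theorem dualityMap_scaledBasis_apply {n : ℕ} (lam : Mn n) (hlam : ∀ i j, lam i j ≠ 0)
    (X Y : Mn n) :
    dualityMap (scaledBasis lam hlam) X Y = ∑ i, ∑ j, X i j * Y i j / lam i j ^ 2 := by
  rw [dualityMap_apply_apply, Fintype.sum_prod_type]
  refine Finset.sum_congr rfl fun i _ => Finset.sum_congr rfl fun j _ => ?_
  rw [scaledBasis_repr_apply, scaledBasis_repr_apply]
  ring

theorem dualityMap_scaledBasis_single {n : ℕ} (lam : Mn n) (hlam : ∀ i j, lam i j ≠ 0)
    (X : Mn n) (a b : Fin n) :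
    dualityMap (scaledBasis lam hlam) X (Matrix.single a b 1) = X a b / lam a b ^ 2 := by
  rw [dualityMap_scaledBasis_apply, Finset.sum_eq_single a, Finset.sum_eq_single b]
  · simp
  · intro j _ hj
    simp [hj.symm]
  · simp
  · intro i _ hi
    simp [hi.symm]
  · simp

theorem dualityMap_stdBasis_apply {n : ℕ} (X Y : Mn n) :
    dualityMap (Matrix.stdBasis ℂ (Fin n) (Fin n)) X Y = ∑ i, ∑ j, X i j * Y i j := by
  rw [dualityMap_apply_apply, Fintype.sum_prod_type]
  simp [Matrix.stdBasis_repr_apply]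

theorem dualityMapTilde_scaledBasis_apply {n : ℕ} (lam : Mn n) (hlam : ∀ i j, lam i j ≠ 0)
    (X : Mn n) :
    dualityMapTilde (scaledBasis lam hlam) X = Matrix.of fun i j => X i j / lam i j ^ 2 := by
  rw [dualityMapTilde, LinearEquiv.trans_apply, LinearEquiv.symm_apply_eq]
  ext Y
  rw [dualityMap_scaledBasis_apply, dualityMap_stdBasis_apply]
  simp [div_mul_eq_mul_div]

/-! ### Rank-one weights give complete order isomorphisms -/

/-- A weighted block sum of a positive semidefinite matrix is positive semidefinite. -/
theorem Matrix.PosSemidef.sum_blocks {ι γ : Type*} [Fintype ι] [Fintype γ] [DecidableEq γ]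
    {Z : Matrix (ι × γ) (ι × γ) ℂ} (hZ : Z.PosSemidef) (β : ι → ℂ) :
    (Matrix.of fun x y => ∑ i, ∑ j, star (β i) * β j * Z (i, x) (j, y) :
      Matrix γ γ ℂ).PosSemidef := by
  -- Compress by the column of blocks `β_i • 1`.
  have h := hZ.conjTranspose_mul_mul_same
    (Matrix.of fun (x : ι × γ) (y : γ) => if x.2 = y then β x.1 else 0)
  convert h using 1
  ext x y
  simp [Matrix.mul_apply, Fintype.sum_prod_type, Finset.sum_mul, apply_ite]
  rw [Finset.sum_comm]
  exact Finset.sum_congr rfl fun _ _ => Finset.sum_congr rfl fun _ _ => by ring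

/-- Pairing two positive semidefinite block matrices blockwise, with a rank-one weight,
yields a positive semidefinite matrix. -/
theorem Matrix.PosSemidef.blockPairing {ι κ ρ : Type*} [Fintype ι] [Fintype κ] [Fintype ρ]
    [DecidableEq κ] [DecidableEq ρ] {P : Matrix (κ × ι) (κ × ι) ℂ}
    {Q : Matrix (ρ × ι) (ρ × ι) ℂ} (hP : P.PosSemidef) (hQ : Q.PosSemidef) (β : ι → ℂ) :
    (Matrix.of fun x y => ∑ i, ∑ j,
      star (β i) * β j * (P (x.2, i) (y.2, j) * Q (x.1, i) (y.1, j)) :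
      Matrix (ρ × κ) (ρ × κ) ℂ).PosSemidef :=
  -- Restricting `P ⊗ Q` to equal `ι`-indices is a Schur product in that index.
  ((hP.kronecker hQ).submatrix
    fun x : ι × (ρ × κ) => ((x.2.2, x.1), (x.2.1, x.1))).sum_blocks β

theorem dualityMap_isCompletelyPositive {n : ℕ} (lam : Mn n) (hlam : ∀ i j, lam i j ≠ 0)
    {α : Fin n → ℂ} (hα : ∀ i j, lam i j ^ 2 = α i * star (α j)) :
    IsCompletelyPositive (dualityMap (scaledBasis lam hlam)).toLinearMap := by
  intro p A hA r Y hY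
  change Matrix.PosSemidef _
  -- This choice gives `star (β i) * β j = (α i * star (α j))⁻¹`, the weight in the pairing.
  have h := Matrix.PosSemidef.blockPairing hA hY fun i => (star (α i))⁻¹
  convert h using 1
  ext ⟨a, k⟩ ⟨b, l⟩
  change dualityMap (scaledBasis lam hlam) (A k l) (Y a b) = _
  rw [dualityMap_scaledBasis_apply, Matrix.of_apply]
  refine Finset.sum_congr rfl fun i _ => Finset.sum_congr rfl fun j _ => ?_
  rw [hα, div_eq_inv_mul, mul_inv, star_inv₀, star_star]
  rfl

/-- The Choi matrix of a positive matrix of functionals is positive semidefinite. -/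
theorem posSemidef_choi {n p : ℕ} {F : Matrix (Fin p) (Fin p) (Module.Dual ℂ (Mn n))}
    (hF : MatrixOrdered.IsPos F) :
    (Matrix.of fun x y => F x.1 y.1 (Matrix.single x.2 y.2 1) :
      Matrix (Fin p × Fin n) (Fin p × Fin n) ℂ).PosSemidef := by
  let E : Matrix (Fin n) (Fin n) (Mn n) := Matrix.of fun a b => Matrix.single a b 1
  have hE : MatrixOrdered.IsPos E := by
    change Matrix.PosSemidef _
    -- The block matrix `(E_{ab})` is `v v*` for `v = ∑ e_a ⊗ e_a`.
    have h := Matrix.posSemidef_vecMulVec_self_star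
      (fun x : Fin n × Fin n => if x.1 = x.2 then (1 : ℂ) else 0)
    convert h using 1
    ext ⟨a, i⟩ ⟨b, j⟩
    simp only [E, Matrix.comp_apply, Matrix.of_apply, Matrix.vecMulVec_apply, Matrix.single_apply,
      Pi.star_apply, apply_ite star, star_one, star_zero, ite_and, ite_mul, one_mul, zero_mul]
  have h : Matrix.PosSemidef _ := hF n E hE
  exact h.submatrix Prod.swap

/-- The Choi matrix of `F` is the preimage of `F` with its entries divided by `λ_{ab}²`; conjugation
by a diagonal matrix built from `α` undoes the division. -/
theorem dualityMap_symm_isCompletelyPositive {n : ℕ} (lam : Mn n) (hlam : ∀ i j, lam i j ≠ 0)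
    {α : Fin n → ℂ} (hα : ∀ i j, lam i j ^ 2 = α i * star (α j)) :
    IsCompletelyPositive (dualityMap (scaledBasis lam hlam)).symm.toLinearMap := by
  intro p F hF
  change Matrix.PosSemidef _
  have h := (posSemidef_choi hF).mul_mul_conjTranspose_same
    (Matrix.diagonal fun x : Fin p × Fin n => α x.2)
  convert h using 1
  ext ⟨k, a⟩ ⟨l, b⟩
  rw [Matrix.diagonal_conjTranspose, Matrix.mul_diagonal, Matrix.diagonal_mul, Matrix.of_apply]
  have hF' : F k l = dualityMap (scaledBasis lam hlam)
      ((dualityMap (scaledBasis lam hlam)).symm (F k l)) := by simp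
  rw [hF', dualityMap_scaledBasis_single]
  have := hα a b
  have h0 := hlam a b
  change (dualityMap (scaledBasis lam hlam)).symm (F k l) a b = _
  rw [Pi.star_apply, mul_right_comm, ← this]
  field_simp

theorem dualityMap_isCompleteOrderIsomorphism {n : ℕ} (lam : Mn n) (hlam : ∀ i j, lam i j ≠ 0)
    {α : Fin n → ℂ} (hα : ∀ i j, lam i j ^ 2 = α i * star (α j)) :
    IsCompleteOrderIsomorphism (dualityMap (scaledBasis lam hlam)) :=
  ⟨dualityMap_isCompletelyPositive lam hlam hα, dualityMap_symm_isCompletelyPositive lam hlam hα⟩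

theorem IsCompleteOrderIsomorphism.isOrderIsomorphism {V W : Type*} [AddCommGroup V]
    [Module ℂ V] [MatrixOrdered V] [AddCommGroup W] [Module ℂ W] [MatrixOrdered W]
    {Φ : V ≃ₗ[ℂ] W} (h : IsCompleteOrderIsomorphism Φ) : IsOrderIsomorphism Φ :=
  ⟨h.1 1, h.2 1⟩

/-! ### Necessary conditions from the all-ones matrix -/

theorem isPos_const_iff {n : ℕ} (X : Mn n) :
    MatrixOrdered.IsPos (Matrix.of fun _ _ : Fin 1 => X) ↔ X.PosSemidef := by
  constructor
  · intro h
    have h' : Matrix.PosSemidef _ := h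
    exact h'.submatrix fun i => (0, i)
  · intro h
    change Matrix.PosSemidef _
    exact h.submatrix Prod.snd

theorem posSemidef_ones (n : ℕ) : (Matrix.of fun _ _ => 1 : Mn n).PosSemidef := by
  convert Matrix.posSemidef_vecMulVec_self_star (fun _ : Fin n => (1 : ℂ)) using 1
  ext i j
  simp [Matrix.vecMulVec_apply]

theorem posSemidef_inv_sq_of_isPositiveMap {n : ℕ} (lam : Mn n) (hlam : ∀ i j, lam i j ≠ 0)
    (h : IsPositiveMap (dualityMap (scaledBasis lam hlam)).toLinearMap) :
    (Matrix.of fun i j => (lam i j ^ 2)⁻¹ : Mn n).PosSemidef := by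
  have h1 := posSemidef_choi (h _ ((isPos_const_iff _).2 (posSemidef_ones n)))
  convert h1.submatrix fun i => (0, i) using 1
  ext i j
  change _ = dualityMap (scaledBasis lam hlam) _ (Matrix.single i j 1)
  rw [dualityMap_scaledBasis_single]
  simp

theorem posSemidef_sq_of_isPositiveMap_symm {n : ℕ} (lam : Mn n) (hlam : ∀ i j, lam i j ≠ 0)
    (h : IsPositiveMap (dualityMap (scaledBasis lam hlam)).symm.toLinearMap) :
    (Matrix.of fun i j => lam i j ^ 2 : Mn n).PosSemidef := by
  let L : Mn n := Matrix.of fun i j => lam i j ^ 2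
  have hone : ∀ i j, (Matrix.of fun _ _ => 1 : Mn n) i j ≠ 0 := fun _ _ => one_ne_zero
  have hpos := dualityMap_isCompletelyPositive (Matrix.of fun _ _ => 1 : Mn n) hone
    (α := fun _ => 1) (by simp) 1 _ ((isPos_const_iff _).2 (posSemidef_ones n))
  -- The positive functional `Y ↦ ∑ y_{ij}` is also the image of `(λ_{ij}²)`, so the inverse map
  -- recovers that matrix.
  have key : dualityMap (scaledBasis (Matrix.of fun _ _ => 1 : Mn n) hone)
      (Matrix.of fun _ _ => 1) = dualityMap (scaledBasis lam hlam) L := by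
    ext Y
    rw [dualityMap_scaledBasis_apply, dualityMap_scaledBasis_apply]
    refine Finset.sum_congr rfl fun i _ => Finset.sum_congr rfl fun j _ => ?_
    have := hlam i j
    simp only [L, Matrix.of_apply]
    field_simp
  refine (isPos_const_iff L).1 ?_
  convert h _ hpos using 1
  ext1 a b
  change L = (dualityMap (scaledBasis lam hlam)).symm
    (dualityMap (scaledBasis (Matrix.of fun _ _ => 1 : Mn n) hone) (Matrix.of fun _ _ => 1))
  rw [key, LinearEquiv.symm_apply_apply]

/-! ### Vanishing minors and rank one -/

theorem Matrix.PosSemidef.apply_mul_apply_le {ι : Type*} [Fintype ι] [DecidableEq ι]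
    {A : Matrix ι ι ℂ} (hA : A.PosSemidef) (i j : ι) : A i j * A j i ≤ A i i * A j j := by
  have h := (hA.submatrix ![i, j]).det_nonneg
  rw [Matrix.det_fin_two] at h
  simpa using h

/-- If a `2 × 2` principal minor of a positive semidefinite matrix vanishes, then so do the
minors sharing its columns and its first row. -/
theorem Matrix.PosSemidef.minor_eq_zero {ι : Type*} [Fintype ι] [DecidableEq ι]
    {A : Matrix ι ι ℂ} (hA : A.PosSemidef) {i j : ι} (h : A i j * A j i = A i i * A j j)
    (k : ι) : A k j * A i i = A k i * A i j := by
  -- The quadratic form at `v` is `conj(A_{ii})` times the vanishing minor, so `v` lies in the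
  -- kernel of `A`.
  let v : ι → ℂ := Pi.single j (A i i) - Pi.single i (A i j)
  have hv : ∀ k, (A *ᵥ v) k = A k j * A i i - A k i * A i j := fun k => by
    simp [v, Matrix.mulVec_sub, mul_comm]
  have h0 : A *ᵥ v = 0 := by
    rw [← hA.dotProduct_mulVec_zero_iff]
    simp [v, star_sub, sub_dotProduct, hv]
    linear_combination (-(starRingEnd ℂ) (A i i)) * h
  have := congrFun h0 k
  rw [hv] at this
  exact sub_eq_zero.1 this

theorem Matrix.PosSemidef.exists_factor {n : ℕ} [NeZero n] {A : Mn n} (hA : A.PosSemidef)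
    (h0 : A 0 0 ≠ 0) (h : ∀ k j, A k j * A 0 0 = A k 0 * A 0 j) :
    ∃ α : Fin n → ℂ, ∀ i j, A i j = α i * star (α j) := by
  have hpos : 0 ≤ A 0 0 := hA.diag_nonneg
  obtain ⟨hre, him⟩ := Complex.le_def.1 hpos
  have hA0 : A 0 0 = ((A 0 0).re : ℂ) := Complex.ext rfl (by simpa using him.symm)
  set t := (A 0 0).re with ht
  have hs : ((Real.sqrt t : ℝ) : ℂ) * (Real.sqrt t : ℝ) = A 0 0 := by
    rw [hA0, ← Complex.ofReal_mul, Real.mul_self_sqrt (by simpa using hre)]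
  have hs0 : ((Real.sqrt t : ℝ) : ℂ) ≠ 0 := fun hz => h0 (by rw [← hs, hz, zero_mul])
  -- Column `0` normalized by `√A_{00}`: the product is `A_{i0} A_{0j} / A_{00}`.
  refine ⟨fun i => A i 0 / (Real.sqrt t : ℝ), fun i j => ?_⟩
  have hstar : star (A j 0) = A 0 j := hA.1.apply 0 j
  have hst : star ((Real.sqrt t : ℝ) : ℂ) = (Real.sqrt t : ℝ) := Complex.conj_ofReal _
  rw [star_div₀, hstar, hst, div_mul_div_comm, hs, ← h, mul_div_assoc, div_self h0, mul_one]

theorem Matrix.minor_eq_zero_of_rank_le_one {n : ℕ} {A : Mn n} (h : A.rank ≤ 1)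
    (i k j : Fin n) : A k j * A i i = A k i * A i j := by
  obtain ⟨v, hv⟩ := finrank_le_one_iff.1 h
  have col : ∀ j, ∃ c : ℂ, ∀ k, A k j = c * v.1 k := fun j => by
    obtain ⟨c, hc⟩ := hv ⟨A.col j, Pi.single j 1, by simp⟩
    exact ⟨c, fun k => by simpa using (congrFun (congrArg Subtype.val hc) k).symm⟩
  obtain ⟨c, hc⟩ := col j
  obtain ⟨d, hd⟩ := col i
  rw [hc, hd, hd, hc]
  ring

theorem Matrix.rank_eq_one_of_factor {n : ℕ} [NeZero n] {A : Mn n} (h0 : A 0 0 ≠ 0)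
    {α : Fin n → ℂ} (h : ∀ i j, A i j = α i * star (α j)) : A.rank = 1 := by
  have hA : A = Matrix.vecMulVec α (star α) := by
    ext i j
    simp [h, Matrix.vecMulVec_apply]
  refine le_antisymm (hA ▸ Matrix.rank_vecMulVec_le _ _) (Nat.one_le_iff_ne_zero.2 fun hr => h0 ?_)
  have hz : A.mulVecLin = 0 := LinearMap.range_eq_bot.1 (Submodule.finrank_eq_zero.1 hr)
  simpa using congrFun (LinearMap.congr_fun hz (Pi.single 0 1)) 0

theorem exists_factor_of_isOrderIsomorphism {n : ℕ} [NeZero n] (lam : Mn n)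
    (hlam : ∀ i j, lam i j ≠ 0)
    (h : IsOrderIsomorphism (dualityMap (scaledBasis lam hlam))) :
    ∃ α : Fin n → ℂ, ∀ i j, lam i j ^ 2 = α i * star (α j) := by
  have h1 := posSemidef_inv_sq_of_isPositiveMap lam hlam h.1
  have h2 := posSemidef_sq_of_isPositiveMap_symm lam hlam h.2
  have hne : ∀ i j, lam i j ^ 2 ≠ 0 := fun i j => pow_ne_zero 2 (hlam i j)
  have hnn : ∀ i j, 0 ≤ lam i j ^ 2 * lam j i ^ 2 := fun i j => by
    have : star (lam i j ^ 2) = lam j i ^ 2 := h2.1.apply j i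
    rw [← this]
    exact mul_star_self_nonneg _
  refine h2.exists_factor (hne 0 0) fun k j => h2.minor_eq_zero (le_antisymm
    (h2.apply_mul_apply_le 0 j) ?_) k
  -- For the entrywise inverse the minor inequality compares reciprocals; clearing denominators
  -- reverses it.
  have hle := h1.apply_mul_apply_le 0 j
  simp only [Matrix.of_apply, ← mul_inv] at hle ⊢
  have hp : 0 < lam 0 j ^ 2 * lam j 0 ^ 2 :=
    lt_of_le_of_ne (hnn 0 j) (mul_ne_zero (hne _ _) (hne _ _)).symm
  have hq : 0 ≤ lam 0 0 ^ 2 * lam j j ^ 2 :=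
    mul_nonneg (h2.diag_nonneg (i := 0)) (h2.diag_nonneg (i := j))
  have := mul_le_mul_of_nonneg_left hle (mul_nonneg hp.le hq)
  rwa [mul_right_comm, mul_inv_cancel₀ hp.ne', one_mul, mul_assoc,
    mul_inv_cancel₀ (mul_ne_zero (hne _ _) (hne _ _)), mul_one] at this

theorem isOrderIsomorphism_iff_exists_factor {n : ℕ} [NeZero n] (lam : Mn n)
    (hlam : ∀ i j, lam i j ≠ 0) :
    IsOrderIsomorphism (dualityMap (scaledBasis lam hlam)) ↔
      ∃ α : Fin n → ℂ, ∀ i j, lam i j ^ 2 = α i * star (α j) :=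
  ⟨exists_factor_of_isOrderIsomorphism lam hlam, fun ⟨_, hα⟩ =>
    (dualityMap_isCompleteOrderIsomorphism lam hlam hα).isOrderIsomorphism⟩

theorem posSemidef_and_rank_eq_one_iff_exists_factor {n : ℕ} [NeZero n] {A : Mn n}
    (h0 : A 0 0 ≠ 0) :
    A.PosSemidef ∧ A.rank = 1 ↔ ∃ α : Fin n → ℂ, ∀ i j, A i j = α i * star (α j) := by
  constructor
  · rintro ⟨hA, hr⟩
    exact hA.exists_factor h0 (Matrix.minor_eq_zero_of_rank_le_one hr.le 0)
  · rintro ⟨α, hα⟩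
    refine ⟨?_, Matrix.rank_eq_one_of_factor h0 hα⟩
    convert Matrix.posSemidef_vecMulVec_self_star α using 1
    ext i j
    simp [hα, Matrix.vecMulVec_apply]

/-! ### Diagonal conjugation, orthonormality and the main theorem -/

theorem conjMap_diagonal_apply {n : ℕ} (α : Fin n → ℂ) (X : Mn n) (i j : Fin n) :
    conjMap (Matrix.diagonal α) X i j = α i * X i j * star (α j) := by
  simp [conjMap, Matrix.diagonal_conjTranspose, Matrix.mul_diagonal, Matrix.diagonal_mul]

theorem dualityMapTilde_toLinearMap_eq_conjMap {n : ℕ} (lam : Mn n) (hlam : ∀ i j, lam i j ≠ 0)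
    {α : Fin n → ℂ} (hα : ∀ i j, lam i j ^ 2 = α i * star (α j)) :
    (dualityMapTilde (scaledBasis lam hlam)).toLinearMap = conjMap (Matrix.diagonal α⁻¹) := by
  ext1 X
  ext i j
  rw [LinearEquiv.coe_coe, dualityMapTilde_scaledBasis_apply, conjMap_diagonal_apply,
    Matrix.of_apply, hα, div_eq_mul_inv, mul_inv]
  simp only [Pi.inv_apply, star_inv₀]
  ring

theorem dualityMapTilde_symm_toLinearMap_eq_conjMap {n : ℕ} (lam : Mn n)
    (hlam : ∀ i j, lam i j ≠ 0) {α : Fin n → ℂ}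
    (hα : ∀ i j, lam i j ^ 2 = α i * star (α j)) :
    (dualityMapTilde (scaledBasis lam hlam)).symm.toLinearMap =
      conjMap (Matrix.diagonal α) := by
  ext1 X
  rw [LinearEquiv.coe_coe, LinearEquiv.symm_apply_eq, dualityMapTilde_scaledBasis_apply]
  ext i j
  have := hlam i j
  rw [Matrix.of_apply, conjMap_diagonal_apply, mul_right_comm, ← hα]
  field_simp

theorem isHSOrthonormal_scaledBasis {n : ℕ} (lam : Mn n) (hlam : ∀ i j, lam i j ≠ 0)
    (h : ∀ i j, lam i j * star (lam i j) = 1) : IsHSOrthonormal (scaledBasis lam hlam) := by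
  rintro ⟨i, j⟩ ⟨k, l⟩
  rw [scaledBasis_apply, scaledBasis_apply, Matrix.conjTranspose_single]
  by_cases hjl : j = l
  · subst hjl
    by_cases hik : i = k
    · subst hik
      simp [h, -RCLike.star_def, -Complex.star_def]
    · simp [hik]
  · simp [hjl]

theorem mainTheorem6 (n : ℕ) [NeZero n] :
    (∀ (lam : Mn n) (hlam : ∀ i j, lam i j ≠ 0),
      (IsOrderIsomorphism (dualityMap (scaledBasis lam hlam)) ↔
        (Matrix.of fun i j => lam i j ^ 2 : Mn n).PosSemidef ∧
          (Matrix.of fun i j => lam i j ^ 2 : Mn n).rank = 1) ∧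
      (IsOrderIsomorphism (dualityMap (scaledBasis lam hlam)) →
        (∃ α : Fin n → ℂ, ∀ i j, lam i j ^ 2 = α i * star (α j)) ∧
        (∀ α : Fin n → ℂ, (∀ i j, lam i j ^ 2 = α i * star (α j)) →
          IsUnit (Matrix.diagonal α) ∧
          (dualityMapTilde (scaledBasis lam hlam)).symm.toLinearMap =
            conjMap (Matrix.diagonal α) ∧
          (dualityMapTilde (scaledBasis lam hlam)).toLinearMap =
            conjMap (Matrix.diagonal α)⁻¹) ∧
        IsCompleteOrderIsomorphism (dualityMap (scaledBasis lam hlam)))) ∧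
    (∃ (mu : Mn n) (hmu : ∀ i j, mu i j ≠ 0),
      (mu 0 0 = Complex.I ∧ ∀ i j, (i, j) ≠ (0, 0) → mu i j = 1) ∧
      IsHSOrthonormal (scaledBasis mu hmu) ∧
      ¬ IsOrderIsomorphism (dualityMap (scaledBasis mu hmu))) := by
  refine ⟨fun lam hlam => ⟨?_, fun h => ?_⟩, ?_⟩
  · rw [posSemidef_and_rank_eq_one_iff_exists_factor (pow_ne_zero 2 (hlam 0 0)),
      isOrderIsomorphism_iff_exists_factor]
    rfl
  · obtain ⟨α, hα⟩ := exists_factor_of_isOrderIsomorphism lam hlam h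
    refine ⟨⟨α, hα⟩, fun γ hγ => ?_, dualityMap_isCompleteOrderIsomorphism lam hlam hα⟩
    have hγ0 : ∀ i, γ i ≠ 0 := fun i hi => pow_ne_zero 2 (hlam i i) (by rw [hγ, hi, zero_mul])
    have hunit : IsUnit γ := Pi.isUnit_iff.2 fun i => (hγ0 i).isUnit
    refine ⟨Matrix.isUnit_diagonal.2 hunit,
      dualityMapTilde_symm_toLinearMap_eq_conjMap lam hlam hγ, ?_⟩
    have hinv : (Matrix.diagonal γ)⁻¹ = Matrix.diagonal γ⁻¹ := by
      refine Matrix.inv_eq_right_inv ?_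
      rw [Matrix.diagonal_mul_diagonal, ← Matrix.diagonal_one]
      congr 1
      ext i
      simp [hγ0 i]
    rw [hinv, dualityMapTilde_toLinearMap_eq_conjMap lam hlam hγ]
  · let mu : Mn n := Matrix.of fun i j => if (i, j) = (0, 0) then Complex.I else 1
    have h00 : mu 0 0 = Complex.I := by simp [mu]
    have hne : ∀ i j, (i, j) ≠ (0, 0) → mu i j = 1 := fun i j h => if_neg h
    have hmu : ∀ i j, mu i j * star (mu i j) = 1 := fun i j => by
      by_cases h : (i, j) = (0, 0)
      · obtain ⟨rfl, rfl⟩ := Prod.mk.inj h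
        simp [h00]
      · simp [hne i j h]
    have hmu0 : ∀ i j, mu i j ≠ 0 := fun i j h => by simpa [h] using hmu i j
    refine ⟨mu, hmu0, ⟨h00, hne⟩, isHSOrthonormal_scaledBasis mu hmu0 hmu, fun h => ?_⟩
    have h2 := (posSemidef_sq_of_isPositiveMap_symm mu hmu0 h.2).diag_nonneg (i := 0)
    rw [Matrix.of_apply, h00, Complex.I_sq] at h2
    have := (Complex.le_def.1 h2).1
    norm_num at this
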